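/- Let $q$ be a power of a prime $p$, let $\mathbb F_q$ be the finite field with $q$ elements, let $n\ge 0$ be an integer and $V_n=\mathbb F_q^n$. The functional graph $G(T/V_n)$ of a map $T:V_n\to V_n$ is the directed graph with vertex set $V_n$ and edges $v\to T(v)$. Write $T\sim S$ if $S=f^{-1}\circ T\circ f$ for some (not necessarily linear) bijection $f:V_n\to V_n$; equivalently, if the functional graphs of $S$ and $T$ are isomorphic. For a bijective linear map $T:V_n\to V_n$ there is a decomposition $V_n=\bigoplus_{i=1}^{m}U_i$ into $T$-invariant subspaces such that the minimal polynomial of $T$ on $U_i$ is $f_i^{s_i}$, where $s_i\ge 1$, $f_i\in\mathbb F_q[x]$ is monic and irreducible, $f_i\neq x$ and $\deg(f_i^{s_i})=\dim U_i$; the graph data of $T$ is the family of triples $(\deg(f_i),\operatorname{ord}(f_i),s_i)_{1\le i\le m}$, where $\operatorname{ord}(f)$ is the least $e\ge 1$ such that $f$ divides $x^e-1$. **Theorem.** Let $S,T:V_n\to V_n$ be bijective $\mathbb F_q$-linear maps such that $T\sim S$ and $G(T/V_n)$ contains no directed cycle of length divisible by $p$. Then $G(S/V_n)$ contains no directed cycle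 of length divisible by $p$ and, up to a permutation of indices, the graph data of $S$ and $T$ (for any choice of the decompositions) coincide. Moreover, if $B_q(n)$ is the number of pairwise non-isomorphic functional graphs arising from bijective $\mathbb F_q$-linear maps $V_n\to V_n$, and $\sigma_i^*$ is the number of positive integers $e$ such that $i=\min\{j>0 : q^j\equiv 1 \pmod e\}$, then $$B_q(n)\ \ge\ \sum_{\lambda\vdash n}\ \prod_{i=1}^n\binom{\sigma_i^*+\lambda_i-1}{\lambda_i},$$ where the sum runs over all partitions $\lambda=(\lambda_1,\dots,\lambda_n)$ of $n$, that is, nonnegative integers $\lambda_i$ with $\sum_{i=1}^n i\lambda_i=n$, and $\binom{-1}{0}=1$. -/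

import Mathlib

open scoped Polynomial

namespace LinearDynamics

/-- The functional graph of `T : X → X`: the vertices are the elements of `X` and the edges are
`v → T v`. -/
def functionalGraph {X : Type*} (T : X → X) : Digraph X where
  Adj v w := w = T v

/-- `G` contains a directed cycle `C_m` of length `m ≥ 1` (a loop is a cycle of length `1`):
pairwise distinct vertices `c 0, …, c (m - 1)`, indexed cyclically, with edges
`c i → c (i + 1)`. -/
def HasCycleOfLength {X : Type*} (G : Digraph X) (m : ℕ) : Prop :=
  0 < m ∧ ∃ c : ZMod m → X, Function.Injective c ∧ ∀ i, G.Adj (c i) (c (i + 1))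

/-- Two self-maps `T : Y → Y` and `S : X → X` are dynamically equivalent, `T ∼ S`, if
`S = f⁻¹ ∘ T ∘ f` for some bijection `f : X → Y`. -/
def DynEquiv {X Y : Type*} (T : Y → Y) (S : X → X) : Prop :=
  ∃ f : X ≃ Y, S = f.symm ∘ T ∘ f

/-- Isomorphism of directed graphs on the same vertex type, as an equivalence relation. -/
def digraphIsoSetoid (X : Type*) : Setoid (Digraph X) where
  r G H := Nonempty (G.Adj ≃r H.Adj)
  iseqv :=
    { refl := fun G => ⟨RelIso.refl G.Adj⟩
      symm := fun ⟨e⟩ => ⟨e.symm⟩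
      trans := fun ⟨e⟩ ⟨e'⟩ => ⟨e.trans e'⟩ }

/-- `B_q(n)` for `q = #F`: the number of isomorphism classes of functional graphs of bijective
`F`-linear maps `F^n → F^n`. -/
noncomputable def numBijectiveGraphs (F : Type*) [Field F] (n : ℕ) : ℕ :=
  Nat.card (Quotient (Setoid.comap
    (fun T : {T : Module.End F (Fin n → F) // Function.Bijective T} => functionalGraph ⇑T.1)
    (digraphIsoSetoid (Fin n → F))))

/-- The order of a polynomial `f`: the least `e ≥ 1` with `f ∣ X ^ e - 1`. Over a finite field such
an `e` exists as soon as `f` is coprime to `X`. -/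
noncomputable def polyOrder {F : Type*} [Field F] (f : F[X]) : ℕ :=
  sInf {e : ℕ | 0 < e ∧ f ∣ Polynomial.X ^ e - 1}

/-- `D` is the graph data of the linear map `T`, read off from some decomposition `V = ⨁ i, U i`
into `T`-invariant subspaces such that the minimal polynomial of `T` on `U i` is `f i ^ s i`, where
`s i ≥ 1`, `f i ≠ X` is monic irreducible and `deg (f i ^ s i) = dim (U i)`: the multiset of the
triples `(deg (f i), ord (f i), s i)`. -/
def IsGraphData {F V : Type*} [Field F] [AddCommGroup V] [Module F V] (T : Module.End F V)
    (D : Multiset (ℕ × ℕ × ℕ)) : Prop :=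
  ∃ (m : ℕ) (U : Fin m → Submodule F V) (f : Fin m → F[X]) (s : Fin m → ℕ)
    (hU : ∀ i, ∀ v ∈ U i, T v ∈ U i),
    DirectSum.IsInternal U ∧
    (∀ i, 0 < s i ∧ (f i).Monic ∧ Irreducible (f i) ∧ f i ≠ Polynomial.X ∧
      minpoly F (T.restrict (hU i)) = f i ^ s i ∧
      (f i ^ s i).natDegree = Module.finrank F (U i)) ∧
    D = (Finset.univ : Finset (Fin m)).val.map fun i => ((f i).natDegree, polyOrder (f i), s i)

/-- `σ_i^*`: the number of positive integers `e` with `ord_e q = i`, that is, such that `i` is the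
least `j > 0` with `q ^ j ≡ 1 (mod e)`. -/
noncomputable def sigmaStar (q i : ℕ) : ℕ :=
  Set.ncard {e : ℕ | 0 < e ∧ IsLeast {j : ℕ | 0 < j ∧ q ^ j ≡ 1 [MOD e]} i}

end LinearDynamics

/-!
If no cycle length of `T` is divisible by `p`, then `T ^ N = 1` for some `N` prime to `p`. As
`X ^ N - 1` is separable, all exponents `s i` are `1`, for `T` and for every `S ∼ T`. The degree of
`f i` is the order of `q` modulo `e i = ord (f i)`, so the graph data is determined by the multiset
of the `e i`. The number of `v` with `T ^ k v = v` is `q ^ ∑ deg (f i)`, the sum running over the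
`i` with `e i ∣ k`, and it depends only on the functional graph; inverting these sums over the
divisors of `k` recovers the multiset of the `e i`.

Conversely, factors of cyclotomic polynomials realise every multiset of integers `e` prime to `q`
for which the orders of `q` modulo the `e` add up to `n`. These orders form a partition of `n`, and
the multisets with a given partition are counted by a product of binomial coefficients.
-/

namespace LinearDynamics

open Function Polynomial

universe u

section Dynamics

variable {X Y : Type*} {T : Y → Y} {S : X → X}

theorem hasCycleOfLength_minimalPeriod {x : X} (hx : 0 < minimalPeriod S x) :
    HasCycleOfLength (functionalGraph S) (minimalPeriod S x) := by
  have : NeZero (minimalPeriod S x) := ⟨hx.ne'⟩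
  refine ⟨hx, fun i => S^[i.val] x, fun i j hij => ?_, fun i => ?_⟩
  · exact ZMod.val_injective _
      (iterate_injOn_Iio_minimalPeriod (ZMod.val_lt i) (ZMod.val_lt j) hij)
  · change S^[(i + 1).val] x = S (S^[i.val] x)
    rw [← iterate_succ_apply' S, ZMod.val_add, iterate_mod_minimalPeriod_eq,
      ← iterate_mod_minimalPeriod_eq (n := _ + _), ← iterate_mod_minimalPeriod_eq (n := _ + 1),
      ZMod.val_one_eq_one_mod, Nat.add_mod_mod]

theorem DynEquiv.exists_semiconj (h : DynEquiv T S) : ∃ f : X ≃ Y, Semiconj f S T := by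
  obtain ⟨f, rfl⟩ := h
  exact ⟨f, fun x => f.apply_symm_apply _⟩

theorem dynEquiv_of_iso (e : (functionalGraph S).Adj ≃r (functionalGraph T).Adj) :
    DynEquiv T S :=
  ⟨e.toEquiv, funext fun _ => e.toEquiv.eq_symm_apply.mpr (e.map_rel_iff.mpr rfl)⟩

theorem HasCycleOfLength.of_dynEquiv (h : DynEquiv T S) {m : ℕ}
    (hc : HasCycleOfLength (functionalGraph S) m) : HasCycleOfLength (functionalGraph T) m := by
  obtain ⟨f, hf⟩ := h.exists_semiconj
  obtain ⟨hm, c, hc, hadj⟩ := hc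
  exact ⟨hm, f ∘ c, f.injective.comp hc, fun i => (congrArg f (hadj i)).trans (hf (c i))⟩

theorem DynEquiv.card_ptsOfPeriod_eq (h : DynEquiv T S) (k : ℕ) :
    Nat.card (ptsOfPeriod S k) = Nat.card (ptsOfPeriod T k) := by
  obtain ⟨f, hf⟩ := h.exists_semiconj
  refine Nat.card_congr (f.subtypeEquiv fun x => ?_)
  change S^[k] x = x ↔ T^[k] (f x) = f x
  rw [← hf.iterate_right k x, f.apply_eq_iff_eq]

theorem DynEquiv.iterate_eq_id (h : DynEquiv T S) {N : ℕ} (hT : T^[N] = id) : S^[N] = id := by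
  obtain ⟨f, hf⟩ := h.exists_semiconj
  exact funext fun x => f.injective (by rw [hf.iterate_right N x, hT, id, id])

theorem exists_iterate_eq_id_of_forall_not_dvd [Finite X] (hS : Injective S) {p : ℕ}
    (hp : p.Prime) (h : ∀ m, HasCycleOfLength (functionalGraph S) m → ¬ p ∣ m) :
    ∃ N, ¬ p ∣ N ∧ S^[N] = id := by
  cases nonempty_fintype X
  refine ⟨∏ x, minimalPeriod S x, fun hdvd => ?_, funext fun x => ?_⟩
  · obtain ⟨x, -, hx⟩ := hp.prime.exists_mem_finset_dvd hdvd
    exact h _ (hasCycleOfLength_minimalPeriod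
      (minimalPeriod_pos_of_mem_periodicPts (hS.mem_periodicPts x))) hx
  · exact (isPeriodicPt_minimalPeriod S x).trans_dvd
      (Finset.dvd_prod_of_mem _ (Finset.mem_univ x))

theorem card_ptsOfPeriod_piMap {ι : Type*} [Fintype ι] {W : ι → Type*} (A : ∀ i, W i → W i)
    (k : ℕ) : Nat.card (ptsOfPeriod (Pi.map A) k) = ∏ i, Nat.card (ptsOfPeriod (A i) k) := by
  rw [← Nat.card_pi]
  exact Nat.card_congr ((Equiv.subtypeEquivRight fun _ => isPeriodicPt_piMap).trans
    (Equiv.subtypePiEquivPi (p := fun {i} w => w ∈ ptsOfPeriod (A i) k)))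

end Dynamics

section Multiset

theorem eq_of_sum_divisors_eq {M : Type*} [AddCommMonoid M] [IsCancelAdd M] {f g : ℕ → M}
    (h : ∀ k, 0 < k → ∑ d ∈ k.divisors, f d = ∑ d ∈ k.divisors, g d) (k : ℕ) (hk : 0 < k) :
    f k = g k := by
  induction k using Nat.strong_induction_on with
  | _ k ih =>
    have hproper : ∑ d ∈ k.properDivisors, f d = ∑ d ∈ k.properDivisors, g d :=
      Finset.sum_congr rfl fun d hd =>
        ih d (Nat.mem_properDivisors.mp hd).2 (Nat.pos_of_mem_properDivisors hd)
    have hsum := h k hk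
    rw [← Nat.cons_self_properDivisors hk.ne', Finset.sum_cons, Finset.sum_cons, hproper] at hsum
    exact add_right_cancel hsum

theorem sum_map_filter_dvd_eq_sum_divisors (w : ℕ → ℕ) (E : Multiset ℕ) {k : ℕ} (hk : 0 < k) :
    ((E.filter (· ∣ k)).map w).sum = ∑ d ∈ k.divisors, E.count d * w d := by
  have hsub : (E.filter (· ∣ k)).toFinset ⊆ k.divisors := fun d hd =>
    Nat.mem_divisors.mpr ⟨(Multiset.mem_filter.mp (Multiset.mem_toFinset.mp hd)).2, hk.ne'⟩
  rw [Finset.sum_multiset_map_count, Finset.sum_subset hsub fun d _ hd => by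
    rw [Multiset.count_eq_zero.mpr (mt Multiset.mem_toFinset.mpr hd), zero_smul]]
  exact Finset.sum_congr rfl fun d hd => by
    rw [Multiset.count_filter_of_pos (p := (· ∣ k)) (Nat.dvd_of_mem_divisors hd), smul_eq_mul]

theorem multiset_eq_of_sum_filter_dvd_eq {w : ℕ → ℕ} {E E' : Multiset ℕ}
    (hE : ∀ e ∈ E, 0 < e ∧ 0 < w e) (hE' : ∀ e ∈ E', 0 < e ∧ 0 < w e)
    (h : ∀ k, 0 < k → ((E.filter (· ∣ k)).map w).sum = ((E'.filter (· ∣ k)).map w).sum) :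
    E = E' := by
  have hmul : ∀ k, 0 < k → E.count k * w k = E'.count k * w k := eq_of_sum_divisors_eq
    fun k hk => by
      rw [← sum_map_filter_dvd_eq_sum_divisors w E hk, h k hk,
        sum_map_filter_dvd_eq_sum_divisors w E' hk]
  ext e
  by_cases he : 0 < e ∧ 0 < w e
  · exact Nat.eq_of_mul_eq_mul_right he.2 (hmul e he.1)
  · rw [Multiset.count_eq_zero.mpr (mt (hE e) he), Multiset.count_eq_zero.mpr (mt (hE' e) he)]

end Multiset
section CyclicDecomposition

variable {F : Type u} {V ι : Type*} [Field F] [AddCommGroup V] [Module F V]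
  {T : Module.End F V}

/-- `V`, as an `F[X]`-module on which `X` acts as `T`, is the direct sum of the cyclic modules
`F[X] / (g i)`: a linear isomorphism carries `T` to multiplication by the class of `X` in each
`AdjoinRoot (g i)`. -/
def HasCyclicDecomposition (T : Module.End F V) (g : ι → F[X]) : Prop :=
  ∃ ψ : V ≃ₗ[F] ∀ i, AdjoinRoot (g i), ∀ v, ψ (T v) = (fun i => AdjoinRoot.root (g i)) * ψ v

theorem isUnit_root_iff_isCoprime {R : Type*} [CommRing R] {g : R[X]} :
    IsUnit (AdjoinRoot.root g) ↔ IsCoprime X g := by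
  constructor
  · intro h
    obtain ⟨b, hb⟩ := h.exists_left_inv
    obtain ⟨a, rfl⟩ := AdjoinRoot.mk_surjective b
    rw [← AdjoinRoot.mk_X, ← map_mul, ← map_one (AdjoinRoot.mk g), AdjoinRoot.mk_eq_mk] at hb
    obtain ⟨c, hc⟩ := hb
    exact ⟨a, -c, by linear_combination hc⟩
  · rintro ⟨a, b, hab⟩
    refine IsUnit.of_mul_eq_one_right (AdjoinRoot.mk g a) ?_
    have := congrArg (AdjoinRoot.mk g) hab
    simpa using this

theorem isCoprime_X_iff_ne_X {f : F[X]} (hm : f.Monic) (hf : Irreducible f) :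
    IsCoprime X f ↔ f ≠ X := by
  rw [irreducible_X.coprime_iff_not_dvd, not_iff_not]
  exact ⟨fun h => eq_of_monic_of_associated hm monic_X (irreducible_X.associated_of_dvd hf h).symm,
    fun h => h ▸ dvd_rfl⟩

namespace HasCyclicDecomposition

theorem bijective_iff {g : ι → F[X]} (h : HasCyclicDecomposition T g) :
    Bijective T ↔ ∀ i, IsCoprime X (g i) := by
  obtain ⟨ψ, hψ⟩ := h
  have hcomp : ψ ∘ T = ((fun i => AdjoinRoot.root (g i)) * ·) ∘ ψ := funext hψ
  simp_rw [← isUnit_root_iff_isCoprime]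
  rw [← ψ.bijective.of_comp_iff', hcomp, Bijective.of_comp_iff _ ψ.bijective,
    ← IsUnit.isUnit_iff_mulLeft_bijective, Pi.isUnit_iff]

theorem of_associated {g g' : ι → F[X]} (h : HasCyclicDecomposition T g)
    (hg : ∀ i, Associated (g i) (g' i)) : HasCyclicDecomposition T g' := by
  obtain ⟨ψ, hψ⟩ := h
  refine ⟨ψ.trans (LinearEquiv.piCongrRight fun i =>
    (AdjoinRoot.algEquivOfAssociated F (g i) (g' i) (hg i)).toLinearEquiv), fun v => ?_⟩
  ext i
  simp [hψ]

theorem restrict_of_isUnit {g : ι → F[X]} (h : HasCyclicDecomposition T g) {p : ι → Prop}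
    (hp : ∀ i, ¬ p i → IsUnit (g i)) :
    HasCyclicDecomposition T fun i : Subtype p => g i := by
  classical
  obtain ⟨ψ, hψ⟩ := h
  have hsub : ∀ i, ¬ p i → Subsingleton (AdjoinRoot (g i)) := fun i hi =>
    Ideal.Quotient.subsingleton_iff.mpr (Ideal.span_singleton_eq_top.mpr (hp i hi))
  let ρ : (∀ i, AdjoinRoot (g i)) →ₗ[F] ∀ i : Subtype p, AdjoinRoot (g i) :=
    LinearMap.pi fun i => LinearMap.proj (i : ι)
  have hρ : Bijective ρ := by
    refine ⟨fun w w' hw => funext fun i => ?_, fun w =>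
      ⟨fun i => if hi : p i then w ⟨i, hi⟩ else 0, funext fun i => dif_pos i.2⟩⟩
    by_cases hi : p i
    · exact congrFun hw ⟨i, hi⟩
    · have := hsub i hi
      exact Subsingleton.elim _ _
  exact ⟨ψ.trans (LinearEquiv.ofBijective ρ hρ), fun v => congrArg ρ (hψ v)⟩

end HasCyclicDecomposition

theorem exists_hasCyclicDecomposition [Fintype ι] [Module.Finite F V] (g : ι → F[X])
    (hg : ∀ i, g i ≠ 0) (hsum : ∑ i, (g i).natDegree = Module.finrank F V) :
    ∃ T : Module.End F V, HasCyclicDecomposition T g := by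
  have (i : ι) : Module.Finite F (AdjoinRoot (g i)) := (AdjoinRoot.powerBasis (hg i)).finite
  have hrank : Module.finrank F V = Module.finrank F (∀ i, AdjoinRoot (g i)) := by
    rw [Module.finrank_pi_fintype, ← hsum]
    exact Finset.sum_congr rfl fun i _ => finrank_quotient_span_eq_natDegree.symm
  let ψ := LinearEquiv.ofFinrankEq V (∀ i, AdjoinRoot (g i)) hrank
  exact ⟨ψ.symm.conj (Algebra.lmul F _ fun i => AdjoinRoot.root (g i)), ψ, fun v => by
    simp [LinearEquiv.conj_apply]⟩

theorem exists_hasCyclicDecomposition_irreducible_pow [Module.Finite F V] (T : Module.End F V) :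
    ∃ (ι : Type u) (_ : Fintype ι) (f : ι → F[X]) (s : ι → ℕ),
      (∀ i, (f i).Monic ∧ Irreducible (f i) ∧ 0 < s i) ∧
      HasCyclicDecomposition T fun i => f i ^ s i := by
  classical
  obtain ⟨ι, _, p, hp, e, ⟨E⟩⟩ :=
    Module.equiv_directSum_of_isTorsion (Module.AEval.isTorsion_of_finiteDimensional F V T)
  have hT : HasCyclicDecomposition T fun i => p i ^ e i := by
    let E' : Module.AEval' T ≃ₗ[F[X]] ∀ i, F[X] ⧸ Submodule.span F[X] {p i ^ e i} :=
      E.trans (DirectSum.linearEquivFunOnFintype F[X] ι _)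
    refine ⟨(Module.AEval'.of T).trans (E'.restrictScalars F), fun v => ?_⟩
    change E' (Module.AEval'.of T (T v)) = _
    rw [← Module.AEval'.X_smul_of, map_smul]
    ext i
    let w : AdjoinRoot (p i ^ e i) := E' (Module.AEval'.of T v) i
    obtain ⟨g, hg⟩ := AdjoinRoot.mk_surjective w
    change (X : F[X]) • E' (Module.AEval'.of T v) i = AdjoinRoot.root (p i ^ e i) * w
    rw [show E' (Module.AEval'.of T v) i = w from rfl, ← hg]
    rfl
  -- The structure theorem allows trivial summands, those with `e i = 0`; they are dropped.
  refine ⟨{i // 0 < e i}, inferInstance, fun i => normalize (p i), fun i => e i,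
    fun i => ⟨monic_normalize (hp i).ne_zero, ?_, i.2⟩, ?_⟩
  · exact (associated_normalize _).irreducible (hp i)
  · refine (hT.of_associated fun i => (associated_normalize (p i)).pow_pow).restrict_of_isUnit
      fun i hi => ?_
    simp [Nat.eq_zero_of_not_pos hi]

theorem minpoly_restrict_range {W : Type*} [AddCommGroup W] [Module F W] {A : Module.End F W}
    {φ : W →ₗ[F] V} (hφ : Injective φ) (h : ∀ w, T (φ w) = φ (A w))
    (hU : ∀ v ∈ LinearMap.range φ, T v ∈ LinearMap.range φ) :
    minpoly F (T.restrict hU) = minpoly F A := by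
  rw [← minpoly.algEquiv_eq ((LinearEquiv.ofInjective φ hφ).conjAlgEquiv F) A]
  congr 1
  ext ⟨v, w, rfl⟩
  have : (LinearEquiv.ofInjective φ hφ).symm ⟨φ w, w, rfl⟩ = w :=
    (LinearEquiv.symm_apply_eq _).mpr rfl
  simp [LinearEquiv.conjAlgEquiv_apply, this, h]

theorem minpoly_lmul_root {g : F[X]} (hg : g.Monic) :
    minpoly F (Algebra.lmul F (AdjoinRoot g) (AdjoinRoot.root g)) = g := by
  rw [minpoly.algHom_eq _ Algebra.lmul_injective, AdjoinRoot.minpoly_root hg.ne_zero,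
    hg.leadingCoeff, inv_one, C_1, mul_one]

theorem isInternal_range_symm_comp_single [Finite ι] [DecidableEq ι] {W : ι → Type*}
    [∀ i, AddCommGroup (W i)] [∀ i, Module F (W i)] (ψ : V ≃ₗ[F] ∀ i, W i) :
    DirectSum.IsInternal fun i =>
      LinearMap.range (ψ.symm.toLinearMap ∘ₗ LinearMap.single F W i) := by
  have hind : iSupIndep fun i => LinearMap.range (LinearMap.single F W i) := fun i =>
    by simpa using LinearMap.disjoint_single_single F W {i} {i}ᶜ disjoint_compl_right
  simp_rw [LinearMap.range_comp]
  rw [DirectSum.isInternal_submodule_iff_iSupIndep_and_iSup_eq_top]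
  refine ⟨LinearMap.iSupIndep_map _ ψ.symm.injective hind, ?_⟩
  rw [← Submodule.map_iSup, LinearMap.iSup_range_single, Submodule.map_top]
  exact LinearEquiv.range _

theorem isGraphData_of_isInternal [Fintype ι] [DecidableEq ι] {U : ι → Submodule F V}
    {f : ι → F[X]} {s : ι → ℕ} (hU : ∀ i, ∀ v ∈ U i, T v ∈ U i) (hint : DirectSum.IsInternal U)
    (h : ∀ i, 0 < s i ∧ (f i).Monic ∧ Irreducible (f i) ∧ f i ≠ X ∧
      minpoly F (T.restrict (hU i)) = f i ^ s i ∧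
      (f i ^ s i).natDegree = Module.finrank F (U i)) :
    IsGraphData T (Finset.univ.val.map fun i => ((f i).natDegree, polyOrder (f i), s i)) := by
  let e := (Fintype.equivFin ι).symm
  refine ⟨Fintype.card ι, U ∘ e, f ∘ e, s ∘ e, fun i => hU (e i), ?_, fun i => h (e i), ?_⟩
  · rw [DirectSum.isInternal_submodule_iff_iSupIndep_and_iSup_eq_top] at hint ⊢
    exact ⟨hint.1.comp e.injective, (e.iSup_comp (g := U)).trans hint.2⟩
  · rw [← Multiset.map_univ_val_equiv e, Multiset.map_map]
    rfl

theorem HasCyclicDecomposition.isGraphData [Fintype ι] {f : ι → F[X]} {s : ι → ℕ}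
    (h : HasCyclicDecomposition T fun i => f i ^ s i)
    (hfs : ∀ i, (f i).Monic ∧ Irreducible (f i) ∧ 0 < s i) (hX : ∀ i, f i ≠ X) :
    IsGraphData T (Finset.univ.val.map fun i => ((f i).natDegree, polyOrder (f i), s i)) := by
  classical
  obtain ⟨ψ, hψ⟩ := h
  let φ (i : ι) : AdjoinRoot (f i ^ s i) →ₗ[F] V :=
    ψ.symm.toLinearMap ∘ₗ LinearMap.single F (fun i => AdjoinRoot (f i ^ s i)) i
  have hφ : ∀ i, Injective (φ i) := fun i =>
    ψ.symm.injective.comp (Pi.single_injective (M := fun i => AdjoinRoot (f i ^ s i)) i)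
  have hTφ : ∀ i w, T (φ i w) = φ i (Algebra.lmul F _ (AdjoinRoot.root (f i ^ s i)) w) :=
    fun i w => ψ.injective <| by
      change ψ (T (ψ.symm (Pi.single i w))) = ψ (ψ.symm (Pi.single i _))
      rw [hψ, ψ.apply_symm_apply, ψ.apply_symm_apply]
      exact (Pi.single_mul_right _).symm
  have hU : ∀ i, ∀ v ∈ LinearMap.range (φ i), T v ∈ LinearMap.range (φ i) := by
    rintro i _ ⟨w, rfl⟩
    exact ⟨_, (hTφ i w).symm⟩
  refine isGraphData_of_isInternal hU (isInternal_range_symm_comp_single ψ) fun i => ?_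
  obtain ⟨hm, hf, hs⟩ := hfs i
  refine ⟨hs, hm, hf, hX i, ?_, ?_⟩
  · rw [minpoly_restrict_range (hφ i) (hTφ i) (hU i), minpoly_lmul_root (hm.pow _)]
  · rw [LinearMap.finrank_range_of_inj (hφ i)]
    exact finrank_quotient_span_eq_natDegree.symm

theorem exists_isGraphData [Module.Finite F V] (hT : Bijective T) : ∃ D, IsGraphData T D := by
  obtain ⟨ι, _, f, s, hfs, h⟩ := exists_hasCyclicDecomposition_irreducible_pow T
  refine ⟨_, h.isGraphData hfs fun i => ?_⟩
  obtain ⟨hm, hf, hs⟩ := hfs i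
  exact (isCoprime_X_iff_ne_X hm hf).mp
    ((IsCoprime.pow_right_iff hs).mp (h.bijective_iff.mp hT i))

end CyclicDecomposition
section OrdMod

/-- The order of `q` modulo `e`: the least `j > 0` with `q ^ j ≡ 1 (mod e)`, or `0` if there is no
such `j`. -/
noncomputable def ordMod (q e : ℕ) : ℕ :=
  orderOf (q : ZMod e)

theorem ordMod_dvd_iff {q e j : ℕ} : ordMod q e ∣ j ↔ q ^ j ≡ 1 [MOD e] := by
  rw [ordMod, orderOf_dvd_iff_pow_eq_one, ← ZMod.natCast_eq_natCast_iff, Nat.cast_pow, Nat.cast_one]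

end OrdMod

section PolyOrder

variable {F : Type*} [Field F]

theorem dvd_X_pow_sub_one_iff_root_pow_eq_one (f : F[X]) (k : ℕ) :
    f ∣ X ^ k - 1 ↔ AdjoinRoot.root f ^ k = 1 := by
  rw [← AdjoinRoot.mk_eq_zero, map_sub, map_pow, AdjoinRoot.mk_X, map_one, sub_eq_zero]

theorem polyOrder_eq_orderOf_root (f : F[X]) : polyOrder f = orderOf (AdjoinRoot.root f) := by
  simp_rw [polyOrder, dvd_X_pow_sub_one_iff_root_pow_eq_one]
  rcases Nat.eq_zero_or_pos (orderOf (AdjoinRoot.root f)) with h | h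
  · rw [h, Nat.sInf_eq_zero]
    exact .inr (Set.eq_empty_of_forall_notMem fun e he => orderOf_eq_zero_iff'.mp h e he.1 he.2)
  · exact IsLeast.csInf_eq
      ⟨⟨h, pow_orderOf_eq_one _⟩, fun e he => orderOf_le_of_pow_eq_one he.1 he.2⟩

theorem polyOrder_dvd_iff (f : F[X]) (k : ℕ) : polyOrder f ∣ k ↔ f ∣ X ^ k - 1 := by
  rw [polyOrder_eq_orderOf_root, dvd_X_pow_sub_one_iff_root_pow_eq_one, orderOf_dvd_iff_pow_eq_one]

theorem polyOrder_eq_iff_dvd_cyclotomic {f : F[X]} (hf : Irreducible f) {e : ℕ}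
    (he : (e : F) ≠ 0) : polyOrder f = e ↔ f ∣ cyclotomic e F := by
  have : Fact (Irreducible f) := ⟨hf⟩
  have : NeZero (e : AdjoinRoot f) := ⟨by
    rw [← map_natCast (algebraMap F (AdjoinRoot f))]
    exact (_root_.map_ne_zero _).mpr he⟩
  rw [polyOrder_eq_orderOf_root, ← IsPrimitiveRoot.iff_orderOf, ← isRoot_cyclotomic_iff,
    ← AdjoinRoot.mk_eq_zero, ← AdjoinRoot.aeval_eq, IsRoot.def,
    ← map_cyclotomic e (algebraMap F (AdjoinRoot f)), eval_map_algebraMap]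

theorem exists_monic_irreducible_polyOrder_eq {e : ℕ} (he : (e : F) ≠ 0) :
    ∃ f : F[X], f.Monic ∧ Irreducible f ∧ f ≠ X ∧ polyOrder f = e := by
  have he0 : e ≠ 0 := by
    rintro rfl
    exact he Nat.cast_zero
  obtain ⟨f, hm, hf, hdvd⟩ := exists_monic_irreducible_factor (cyclotomic e F)
    (not_isUnit_of_natDegree_pos _ (by
      rw [natDegree_cyclotomic]
      exact Nat.totient_pos.mpr he0.bot_lt))
  refine ⟨f, hm, hf, ?_, (polyOrder_eq_iff_dvd_cyclotomic hf he).mpr hdvd⟩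
  rintro rfl
  simpa [coeff_zero_eq_eval_zero, he0] using
    X_dvd_iff.mp (hdvd.trans (cyclotomic.dvd_X_pow_sub_one e F))

variable [Finite F]

theorem natCast_ne_zero_of_card_pow_modEq_one {e j : ℕ} (hj : j ≠ 0)
    (h : Nat.card F ^ j ≡ 1 [MOD e]) : (e : F) ≠ 0 := by
  cases nonempty_fintype F
  obtain ⟨c, hc⟩ := (Nat.modEq_iff_dvd' (Nat.one_le_pow _ _ Nat.card_pos)).mp h.symm
  have hcast : Nat.card F ^ j = e * c + 1 := by
    rw [← hc, Nat.sub_add_cancel (Nat.one_le_pow _ _ Nat.card_pos)]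
  intro he
  have := congrArg (Nat.cast : ℕ → F) hcast
  rw [Nat.cast_pow, Nat.cast_add, Nat.cast_mul, he, zero_mul, zero_add, Nat.cast_one,
    Nat.card_eq_fintype_card, Nat.cast_card_eq_zero, zero_pow hj] at this
  exact zero_ne_one this

theorem natDegree_eq_ordMod_of_polyOrder_ne_zero {f : F[X]} (hf : Irreducible f)
    (h : (polyOrder f : F) ≠ 0) : f.natDegree = ordMod (Nat.card F) (polyOrder f) := by
  cases nonempty_fintype F
  obtain ⟨p, hp⟩ := CharP.exists F
  obtain ⟨r, hpp, hr⟩ := FiniteField.card F p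
  have : Fact p.Prime := ⟨hpp⟩
  have hcop : p.Coprime (polyOrder f) := hpp.coprime_iff_not_dvd.mpr fun hdvd =>
    h ((CharP.cast_eq_zero_iff F p _).mpr hdvd)
  rw [natDegree_of_dvd_cyclotomic_of_irreducible hr hcop
    ((polyOrder_eq_iff_dvd_cyclotomic hf h).mp rfl) hf, ← orderOf_units, ZMod.coe_unitOfCoprime,
    ordMod, Nat.card_eq_fintype_card, hr]

theorem card_pow_natDegree_modEq_one {f : F[X]} (hf : Irreducible f) (hX : IsCoprime X f) :
    Nat.card F ^ f.natDegree ≡ 1 [MOD polyOrder f] := by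
  have : Fact (Irreducible f) := ⟨hf⟩
  have := (AdjoinRoot.powerBasis hf.ne_zero).finite
  have : Finite (AdjoinRoot f) := Module.finite_of_finite F
  cases nonempty_fintype (AdjoinRoot f)
  have hcard : Fintype.card (AdjoinRoot f) = Nat.card F ^ f.natDegree := by
    rw [← Nat.card_eq_fintype_card, Module.natCard_eq_pow_finrank (K := F)]
    exact congrArg _ finrank_quotient_span_eq_natDegree
  refine ((Nat.modEq_iff_dvd' (Nat.one_le_pow _ _ Nat.card_pos)).mpr ?_).symm
  rw [polyOrder_eq_orderOf_root, ← hcard]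
  exact orderOf_dvd_of_pow_eq_one
    (FiniteField.pow_card_sub_one_eq_one _ (isUnit_root_iff_isCoprime.mpr hX).ne_zero)

theorem polyOrder_natCast_ne_zero {f : F[X]} (hf : Irreducible f) (hX : IsCoprime X f) :
    (polyOrder f : F) ≠ 0 :=
  natCast_ne_zero_of_card_pow_modEq_one hf.natDegree_pos.ne' (card_pow_natDegree_modEq_one hf hX)

theorem natDegree_eq_ordMod_polyOrder {f : F[X]} (hf : Irreducible f) (hX : IsCoprime X f) :
    f.natDegree = ordMod (Nat.card F) (polyOrder f) :=
  natDegree_eq_ordMod_of_polyOrder_ne_zero hf (polyOrder_natCast_ne_zero hf hX)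

end PolyOrder

section PeriodicPoints

variable {F V : Type*} [Field F] [AddCommGroup V] [Module F V] {T : Module.End F V}

theorem mem_ptsOfPeriod_iff_aeval_eq_zero {v : V} {k : ℕ} :
    v ∈ ptsOfPeriod T k ↔ aeval T (X ^ k - 1 : F[X]) v = 0 := by
  simp only [map_sub, map_pow, aeval_X, map_one, LinearMap.sub_apply, Module.End.one_apply,
    sub_eq_zero, Module.End.coe_pow]
  rfl

theorem ptsOfPeriod_eq_univ_of_minpoly_dvd {k : ℕ} (h : minpoly F T ∣ X ^ k - 1) :
    ptsOfPeriod T k = Set.univ :=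
  Set.eq_univ_of_forall fun v => by
    rw [mem_ptsOfPeriod_iff_aeval_eq_zero, (minpoly.dvd_iff).mp h, LinearMap.zero_apply]

theorem ptsOfPeriod_eq_singleton_of_isCoprime {k : ℕ} (h : IsCoprime (minpoly F T) (X ^ k - 1)) :
    ptsOfPeriod T k = {0} := by
  obtain ⟨a, b, hab⟩ := h
  ext v
  rw [mem_ptsOfPeriod_iff_aeval_eq_zero, Set.mem_singleton_iff]
  refine ⟨fun hv => ?_, fun hv => by rw [hv, map_zero]⟩
  have := congrArg (fun g => aeval T g v) hab
  rw [map_add, map_mul, map_mul, minpoly.aeval, mul_zero, zero_add, map_one,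
    Module.End.mul_apply, hv, map_zero] at this
  exact this.symm

theorem card_ptsOfPeriod_of_isInternal {ι : Type*} [Fintype ι] [DecidableEq ι]
    {U : ι → Submodule F V} (hU : ∀ i, ∀ v ∈ U i, T v ∈ U i) (hint : DirectSum.IsInternal U)
    (k : ℕ) : Nat.card (ptsOfPeriod T k) = ∏ i, Nat.card (ptsOfPeriod (T.restrict (hU i)) k) := by
  classical
  rw [← card_ptsOfPeriod_piMap]
  let ψ : (∀ i, U i) ≃ₗ[F] V := (DirectSum.linearEquivFunOnFintype F ι fun i => U i).symm.trans
    (LinearEquiv.ofBijective (DirectSum.coeLinearMap U) hint)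
  have hψ : ∀ u, ψ u = ∑ i, (u i : V) := fun u => by
    change DirectSum.coeLinearMap U ((DirectSum.linearEquivFunOnFintype F ι _).symm u) = _
    rw [DirectSum.coeLinearMap_eq_dfinsuppSum, DFinsupp.sum_eq_sum_fintype _ fun _ => rfl]
    rfl
  refine DynEquiv.card_ptsOfPeriod_eq ⟨ψ.symm.toEquiv, funext fun v => ?_⟩ k
  obtain ⟨u, rfl⟩ := ψ.surjective v
  change T (ψ u) = ψ (Pi.map _ (ψ.symm (ψ u)))
  rw [ψ.symm_apply_apply, hψ, hψ, map_sum]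
  rfl

variable [Module.Finite F V]

theorem card_ptsOfPeriod_of_irreducible_minpoly (hT : Irreducible (minpoly F T)) (k : ℕ) :
    Nat.card (ptsOfPeriod T k) =
      if polyOrder (minpoly F T) ∣ k then Nat.card F ^ Module.finrank F V else 1 := by
  split_ifs with h <;> rw [polyOrder_dvd_iff] at h
  · rw [ptsOfPeriod_eq_univ_of_minpoly_dvd h, Nat.card_congr (Equiv.Set.univ V),
      Module.natCard_eq_pow_finrank (K := F)]
  · rw [ptsOfPeriod_eq_singleton_of_isCoprime (hT.coprime_iff_not_dvd.mpr h), Nat.card_unique]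

theorem IsGraphData.card_ptsOfPeriod {D : Multiset (ℕ × ℕ × ℕ)} (hD : IsGraphData T D)
    (h1 : ∀ d ∈ D, d.2.2 = 1) (k : ℕ) :
    Nat.card (ptsOfPeriod T k) =
      Nat.card F ^ ((D.filter fun d => d.2.1 ∣ k).map Prod.fst).sum := by
  obtain ⟨m, U, f, s, hU, hint, h, rfl⟩ := hD
  have hcard : ∀ i, Nat.card (ptsOfPeriod (T.restrict (hU i)) k) =
      Nat.card F ^ if polyOrder (f i) ∣ k then (f i).natDegree else 0 := fun i => by
    obtain ⟨-, -, hf, -, hmin, hdeg⟩ := h i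
    have hs : s i = 1 := h1 _ (Multiset.mem_map_of_mem _ (Finset.mem_univ i))
    rw [hs, pow_one] at hmin hdeg
    rw [card_ptsOfPeriod_of_irreducible_minpoly (hmin ▸ hf), hmin, ← hdeg, pow_ite, pow_zero]
  rw [card_ptsOfPeriod_of_isInternal hU hint, Multiset.filter_map, Multiset.map_map]
  simp_rw [hcard]
  rw [Finset.prod_pow_eq_pow_sum, ← Finset.sum_filter]
  rfl

end PeriodicPoints

section SemisimpleData

/-- The graph data of a linear map over the field with `q` elements all of whose elementary
divisors are irreducible, `E` being the multiset of the orders of these polynomials. -/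
noncomputable def semisimpleData (q : ℕ) (E : Multiset ℕ) : Multiset (ℕ × ℕ × ℕ) :=
  E.map fun e => (ordMod q e, e, 1)

variable {F V W : Type*} [Field F] [AddCommGroup V] [Module F V] [AddCommGroup W] [Module F W]
  {T : Module.End F V} {S : Module.End F W}

theorem minpoly_restrict_dvd {U : Submodule F V} (hU : ∀ v ∈ U, T v ∈ U) :
    minpoly F (T.restrict hU) ∣ minpoly F T := by
  have haeval : ∀ (g : F[X]) (v : U), (aeval (T.restrict hU) g v : V) = aeval T g v := by
    intro g v
    simp only [aeval_eq_sum_range, LinearMap.sum_apply, LinearMap.smul_apply,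
      Submodule.coe_sum, Submodule.coe_smul, Module.End.pow_restrict _ hU, LinearMap.restrict_apply]
  refine minpoly.dvd _ _ (LinearMap.ext fun v => Subtype.ext ?_)
  rw [haeval, minpoly.aeval]
  rfl

theorem IsGraphData.exists_irreducible {D : Multiset (ℕ × ℕ × ℕ)} (hD : IsGraphData T D)
    {d : ℕ × ℕ × ℕ} (hd : d ∈ D) :
    ∃ f : F[X], Irreducible f ∧ IsCoprime X f ∧ 0 < d.2.2 ∧ f ^ d.2.2 ∣ minpoly F T ∧
      d.1 = f.natDegree ∧ d.2.1 = polyOrder f := by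
  obtain ⟨m, U, f, s, hU, -, h, rfl⟩ := hD
  obtain ⟨i, -, rfl⟩ := Multiset.mem_map.mp hd
  obtain ⟨hs, hm, hf, hX, hmin, -⟩ := h i
  refine ⟨f i, hf, (isCoprime_X_iff_ne_X hm hf).mpr hX, hs, ?_, rfl, rfl⟩
  exact hmin ▸ minpoly_restrict_dvd (hU i)

theorem IsGraphData.snd_snd_eq_one {D : Multiset (ℕ × ℕ × ℕ)} (hD : IsGraphData T D) {N : ℕ}
    (hN : (N : F) ≠ 0) (hT : T^[N] = id) {d : ℕ × ℕ × ℕ} (hd : d ∈ D) : d.2.2 = 1 := by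
  obtain ⟨f, hf, -, hs, hdvd, -, -⟩ := hD.exists_irreducible hd
  have hTN : minpoly F T ∣ X ^ N - 1 := minpoly.dvd _ _ <| by
    rw [map_sub, map_pow, aeval_X, map_one, sub_eq_zero]
    exact DFunLike.coe_injective (by rw [Module.End.coe_pow, hT]; rfl)
  have hsq : Squarefree (f ^ d.2.2) :=
    (X_pow_sub_one_separable_iff.mpr hN).squarefree.squarefree_of_dvd (hdvd.trans hTN)
  exact (hsq.eq_zero_or_one_of_pow_of_not_isUnit hf.not_isUnit).resolve_left hs.ne'

theorem IsGraphData.card_ptsOfPeriod_semisimpleData [Module.Finite F V] {E : Multiset ℕ}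
    (hE : IsGraphData T (semisimpleData (Nat.card F) E)) (k : ℕ) :
    Nat.card (ptsOfPeriod T k) =
      Nat.card F ^ ((E.filter (· ∣ k)).map (ordMod (Nat.card F))).sum := by
  rw [hE.card_ptsOfPeriod, semisimpleData, Multiset.filter_map, Multiset.map_map]
  · rfl
  · intro d hd
    obtain ⟨e, -, rfl⟩ := Multiset.mem_map.mp hd
    rfl

variable [Finite F]

theorem IsGraphData.fst_eq_ordMod {D : Multiset (ℕ × ℕ × ℕ)} (hD : IsGraphData T D)
    {d : ℕ × ℕ × ℕ} (hd : d ∈ D) : d.1 = ordMod (Nat.card F) d.2.1 := by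
  obtain ⟨f, hf, hX, -, -, hdeg, hord⟩ := hD.exists_irreducible hd
  rw [hdeg, hord, natDegree_eq_ordMod_polyOrder hf hX]

theorem IsGraphData.pos_of_mem_semisimpleData {E : Multiset ℕ}
    (hE : IsGraphData T (semisimpleData (Nat.card F) E)) {e : ℕ} (he : e ∈ E) :
    0 < e ∧ 0 < ordMod (Nat.card F) e := by
  obtain ⟨f, hf, hX, -, -, hdeg, hord⟩ := hE.exists_irreducible (Multiset.mem_map_of_mem _ he)
  refine ⟨?_, hf.natDegree_pos.trans_eq hdeg.symm⟩
  refine Nat.pos_of_ne_zero fun h0 => polyOrder_natCast_ne_zero hf hX ?_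
  rw [← hord]
  exact h0 ▸ Nat.cast_zero

theorem IsGraphData.eq_semisimpleData {D : Multiset (ℕ × ℕ × ℕ)} (hD : IsGraphData T D) {N : ℕ}
    (hN : (N : F) ≠ 0) (hT : T^[N] = id) :
    D = semisimpleData (Nat.card F) (D.map fun d => d.2.1) := by
  rw [semisimpleData, Multiset.map_map]
  refine (Multiset.map_id' D).symm.trans (Multiset.map_congr rfl fun d hd => ?_)
  exact Prod.ext (hD.fst_eq_ordMod hd) (Prod.ext rfl (hD.snd_snd_eq_one hN hT hd))

theorem eq_of_isGraphData_semisimpleData [Module.Finite F V] [Module.Finite F W]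
    (h : DynEquiv T S) {E E' : Multiset ℕ}
    (hE : IsGraphData S (semisimpleData (Nat.card F) E))
    (hE' : IsGraphData T (semisimpleData (Nat.card F) E')) : E = E' := by
  refine multiset_eq_of_sum_filter_dvd_eq (fun e => hE.pos_of_mem_semisimpleData)
    (fun e => hE'.pos_of_mem_semisimpleData) fun k _ =>
      Nat.pow_right_injective (Finite.one_lt_card (α := F)) ?_
  calc Nat.card F ^ ((E.filter (· ∣ k)).map (ordMod (Nat.card F))).sum
      = Nat.card (ptsOfPeriod S k) := (hE.card_ptsOfPeriod_semisimpleData k).symm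
    _ = Nat.card (ptsOfPeriod T k) := h.card_ptsOfPeriod_eq k
    _ = _ := hE'.card_ptsOfPeriod_semisimpleData k

theorem IsGraphData.eq_of_dynEquiv [Module.Finite F V] [Module.Finite F W] (h : DynEquiv T S)
    {N : ℕ} (hN : (N : F) ≠ 0) (hT : T^[N] = id) {DS DT : Multiset (ℕ × ℕ × ℕ)}
    (hDS : IsGraphData S DS) (hDT : IsGraphData T DT) : DS = DT := by
  have hS := hDS.eq_semisimpleData hN (h.iterate_eq_id hT)
  have hT := hDT.eq_semisimpleData hN hT
  rw [hS] at hDS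
  rw [hT] at hDT
  rw [hS, hT, eq_of_isGraphData_semisimpleData h hDS hDT]

theorem exists_isGraphData_semisimpleData [Module.Finite F V] {E : Multiset ℕ}
    (hE : ∀ e ∈ E, 0 < ordMod (Nat.card F) e)
    (hsum : (E.map (ordMod (Nat.card F))).sum = Module.finrank F V) :
    ∃ T : Module.End F V, Bijective T ∧ IsGraphData T (semisimpleData (Nat.card F) E) := by
  choose! f hm hf hX hord using fun e he => exists_monic_irreducible_polyOrder_eq (F := F)
    (natCast_ne_zero_of_card_pow_modEq_one (hE e he).ne' (ordMod_dvd_iff.mp dvd_rfl))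
  have hmem (e : E) : (e : ℕ) ∈ E := Multiset.coe_mem
  have hcop : ∀ e ∈ E, IsCoprime X (f e) := fun e he =>
    (isCoprime_X_iff_ne_X (hm e he) (hf e he)).mpr (hX e he)
  have hdeg : ∀ e ∈ E, (f e).natDegree = ordMod (Nat.card F) e := fun e he => by
    rw [natDegree_eq_ordMod_polyOrder (hf e he) (hcop e he), hord e he]
  obtain ⟨T, hT⟩ := exists_hasCyclicDecomposition (V := V) (fun e : E => f e ^ 1)
    (fun e => pow_ne_zero _ (hf _ (hmem e)).ne_zero) (by
      rw [← hsum, ← Multiset.map_univ E]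
      exact Finset.sum_congr rfl fun e _ => by rw [pow_one, hdeg _ (hmem e)])
  refine ⟨T, hT.bijective_iff.mpr fun e => (hcop _ (hmem e)).pow_right, ?_⟩
  convert hT.isGraphData (fun e => ⟨hm _ (hmem e), hf _ (hmem e), one_pos⟩)
    (fun e => hX _ (hmem e))
  rw [semisimpleData, ← Multiset.map_univ E]
  exact Multiset.map_congr rfl fun e _ => by rw [hdeg _ (hmem e), hord _ (hmem e)]

end SemisimpleData

section Counting

variable {α β : Type*} [DecidableEq β] {w : α → β}

theorem filter_sum_map_val {s : Finset β} (x : ∀ b : s, Multiset {a // w a = b}) (b : s) :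
    (∑ c, (x c).map Subtype.val).filter (fun a => w a = b) = (x b).map Subtype.val := by
  have hfib : ∀ c, ∀ a ∈ (x c).map Subtype.val, w a = c := fun c a ha => by
    obtain ⟨a, -, rfl⟩ := Multiset.mem_map.mp ha
    exact a.2
  calc (∑ c, (x c).map Subtype.val).filter (fun a => w a = b)
      = ∑ c, ((x c).map Subtype.val).filter (fun a => w a = b) :=
        map_sum (⟨⟨Multiset.filter _, Multiset.filter_zero _⟩, Multiset.filter_add _⟩ :
          Multiset α →+ Multiset α) _ _
    _ = ((x b).map Subtype.val).filter (fun a => w a = b) :=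
        Fintype.sum_eq_single b fun c hc => Multiset.filter_eq_nil.mpr fun a ha h =>
          hc (Subtype.ext ((hfib c a ha).symm.trans h))
    _ = (x b).map Subtype.val := Multiset.filter_eq_self.mpr (hfib b)

theorem sum_filter_fiber_eq {s : Finset β} {E : Multiset α} (hE : ∀ a ∈ E, w a ∈ s) :
    ∑ b : s, E.filter (fun a => w a = b) = E := by
  classical
  ext a
  rw [Finset.sum_coe_sort s fun b => E.filter fun a => w a = b, Multiset.count_sum']
  simp_rw [Multiset.count_filter]
  rw [Finset.sum_ite_eq, ite_eq_left_iff]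
  exact fun ha => (Multiset.count_eq_zero.mpr fun h => ha (hE a h)).symm

theorem map_sum_map_val {s : Finset β} {P : Multiset β} (hP : ∀ b ∈ P, b ∈ s)
    (x : ∀ b : s, Sym {a // w a = b} (P.count (b : β))) :
    (∑ b, (x b).1.map Subtype.val).map w = P := by
  have hrep : ∀ b : s, ((x b).1.map Subtype.val).map w = P.filter fun c : β => c = b := fun b => by
    rw [Multiset.filter_eq', Multiset.eq_replicate, Multiset.card_map, Multiset.card_map]
    refine ⟨(x b).2, ?_⟩
    simp only [Multiset.map_map, Multiset.mem_map]
    rintro _ ⟨a, -, rfl⟩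
    exact a.2
  refine (map_sum (Multiset.mapAddMonoidHom w) _ _).trans ?_
  exact (Finset.sum_congr rfl fun b _ => hrep b).trans (sum_filter_fiber_eq (w := id) hP)

theorem natCard_multiset_map_eq {s : Finset β} {P : Multiset β} (hP : ∀ b ∈ P, b ∈ s) :
    Nat.card {E : Multiset α // E.map w = P} =
      ∏ b ∈ s, (Nat.card {a // w a = b}).multichoose (P.count b) := by
  let Φ (x : ∀ b : s, Sym {a // w a = b} (P.count (b : β))) : {E : Multiset α // E.map w = P} :=
    ⟨∑ b, (x b).1.map Subtype.val, map_sum_map_val hP x⟩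
  have hΦ : Bijective Φ := by
    refine ⟨fun x y hxy => funext fun b => ?_, fun E => ?_⟩
    · refine Subtype.ext (Multiset.map_injective Subtype.val_injective ?_)
      rw [← filter_sum_map_val (fun b => (x b).1) b, ← filter_sum_map_val (fun b => (y b).1) b]
      exact congrArg _ (congrArg Subtype.val hxy)
    · obtain ⟨E, rfl⟩ := E
      have hlift (b : s) : ∃ M : Multiset {a // w a = b},
          M.map Subtype.val = E.filter fun a => w a = b :=
        CanLift.prf _ fun a ha => (Multiset.mem_filter.mp ha).2
      choose M hM using hlift
      refine ⟨fun b => ⟨M b, ?_⟩, Subtype.ext ?_⟩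
      · rw [← Multiset.card_map Subtype.val, hM, Multiset.count_map]
        simp only [eq_comm]
      · simp_rw [Φ, hM]
        exact sum_filter_fiber_eq fun a ha => hP _ (Multiset.mem_map_of_mem w ha)
  rw [← Nat.card_congr (Equiv.ofBijective Φ hΦ), Nat.card_pi, ← Finset.prod_coe_sort s]
  exact Finset.prod_congr rfl fun b _ => Sym.natCard_sym_eq_multichoose _ _

end Counting

section Partitions

theorem isLeast_pow_modEq_one_iff {q e i : ℕ} :
    IsLeast {j : ℕ | 0 < j ∧ q ^ j ≡ 1 [MOD e]} i ↔ 0 < i ∧ ordMod q e = i := by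
  simp_rw [← ordMod_dvd_iff]
  constructor
  · rintro ⟨⟨hi, hdvd⟩, hle⟩
    exact ⟨hi, (Nat.le_of_dvd hi hdvd).antisymm (hle ⟨Nat.pos_of_dvd_of_pos hdvd hi, dvd_rfl⟩)⟩
  · rintro ⟨hi, rfl⟩
    exact ⟨⟨hi, dvd_rfl⟩, fun j hj => Nat.le_of_dvd hj.1 hj.2⟩

theorem pos_of_ordMod_pos {q e : ℕ} (hq : 1 < q) (he : 0 < ordMod q e) : 0 < e := by
  refine Nat.pos_of_ne_zero ?_
  rintro rfl
  exact (Nat.one_lt_pow he.ne' hq).ne' (Nat.modEq_zero_iff.mp (ordMod_dvd_iff.mp dvd_rfl))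

theorem sigmaStar_eq_natCard {q i : ℕ} (hq : 1 < q) (hi : 0 < i) :
    sigmaStar q i = Nat.card {e // ordMod q e = i} := by
  rw [sigmaStar, ← Nat.card_coe_set_eq]
  refine Nat.card_congr (Equiv.subtypeEquivRight fun e => ?_)
  change 0 < e ∧ IsLeast _ i ↔ _
  rw [isLeast_pow_modEq_one_iff]
  exact ⟨fun h => h.2.2, fun h => ⟨pos_of_ordMod_pos hq (h ▸ hi), hi, h⟩⟩

theorem mem_Icc_of_mem_parts {n : ℕ} {l : Nat.Partition n} {i : ℕ} (hi : i ∈ l.parts) :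
    i ∈ Finset.Icc 1 n :=
  Finset.mem_Icc.mpr ⟨l.parts_pos hi, l.le_of_mem_parts hi⟩

theorem natCard_map_ordMod_eq_parts {q n : ℕ} (hq : 1 < q) (l : Nat.Partition n) :
    Nat.card {E : Multiset ℕ // E.map (ordMod q) = l.parts} =
      ∏ i ∈ Finset.Icc 1 n, (sigmaStar q i + l.parts.count i - 1).choose (l.parts.count i) := by
  rw [natCard_multiset_map_eq fun i => mem_Icc_of_mem_parts]
  refine Finset.prod_congr rfl fun i hi => ?_
  rw [← sigmaStar_eq_natCard hq (Finset.mem_Icc.mp hi).1, Nat.multichoose_eq]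

theorem sum_prod_choose_le_numBijectiveGraphs (F : Type*) [Field F] [Finite F] (n : ℕ) :
    ∑ l : Nat.Partition n, ∏ i ∈ Finset.Icc 1 n,
        (sigmaStar (Nat.card F) i + l.parts.count i - 1).choose (l.parts.count i) ≤
      numBijectiveGraphs F n := by
  let A := Σ l : Nat.Partition n, {E : Multiset ℕ // E.map (ordMod (Nat.card F)) = l.parts}
  choose T hT hgraph using fun x : A =>
    exists_isGraphData_semisimpleData (F := F) (V := Fin n → F) (E := x.2.1)
      (fun e he => x.1.parts_pos (x.2.2 ▸ Multiset.mem_map_of_mem _ he))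
      (by rw [x.2.2, x.1.parts_sum, Module.finrank_fin_fun])
  let Φ (x : A) : Quotient (Setoid.comap
      (fun T : {T : Module.End F (Fin n → F) // Bijective T} => functionalGraph ⇑T.1)
      (digraphIsoSetoid (Fin n → F))) := Quotient.mk _ ⟨T x, hT x⟩
  have hΦ : Injective Φ := by
    rintro ⟨l, E, hE⟩ ⟨l', E', hE'⟩ h
    obtain ⟨e⟩ := Quotient.exact h
    obtain rfl : E = E' := eq_of_isGraphData_semisimpleData (dynEquiv_of_iso e)
      (hgraph ⟨l, E, hE⟩) (hgraph ⟨l', E', hE'⟩)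
    obtain rfl : l = l' := Nat.Partition.ext (hE.symm.trans hE')
    rfl
  have : Finite (Module.End F (Fin n → F)) := Finite.of_injective _ DFunLike.coe_injective
  have : Finite A := Finite.of_injective Φ hΦ
  have (l : Nat.Partition n) :
      Finite {E : Multiset ℕ // E.map (ordMod (Nat.card F)) = l.parts} :=
    Finite.of_injective (Sigma.mk l : _ → A) sigma_mk_injective
  calc _ = Nat.card A := by
        rw [Nat.card_sigma]
        exact Finset.sum_congr rfl fun l _ =>
          (natCard_map_ordMod_eq_parts Finite.one_lt_card l).symm
    _ ≤ numBijectiveGraphs F n := Nat.card_le_card_of_injective Φ hΦ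

end Partitions

end LinearDynamics

open LinearDynamics in
theorem theorem3p3 (p : ℕ) (F : Type*) [Field F] [Finite F] [CharP F p] (n : ℕ) :
    (∀ S T : Module.End F (Fin n → F), Function.Bijective S → Function.Bijective T →
      DynEquiv T S →
      (∀ m : ℕ, HasCycleOfLength (functionalGraph T) m → ¬ p ∣ m) →
      (∀ m : ℕ, HasCycleOfLength (functionalGraph S) m → ¬ p ∣ m) ∧
      (∃ D, IsGraphData S D) ∧ (∃ D, IsGraphData T D) ∧
      (∀ DS DT : Multiset (ℕ × ℕ × ℕ), IsGraphData S DS → IsGraphData T DT → DS = DT)) ∧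
    ∑ l : Nat.Partition n, ∏ i ∈ Finset.Icc 1 n,
        (sigmaStar (Nat.card F) i + l.parts.count i - 1).choose (l.parts.count i) ≤
      numBijectiveGraphs F n := by
  refine ⟨fun S T hS hT h hcycle => ⟨fun m hm => hcycle m (hm.of_dynEquiv h),
    exists_isGraphData hS, exists_isGraphData hT, fun DS DT hDS hDT => ?_⟩,
    sum_prod_choose_le_numBijectiveGraphs F n⟩
  obtain ⟨N, hpN, hTN⟩ :=
    exists_iterate_eq_id_of_forall_not_dvd hT.1 (CharP.char_is_prime F p) hcycle
  have hN : (N : F) ≠ 0 := mt (CharP.cast_eq_zero_iff F p N).mp hpN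
  exact hDS.eq_of_dynEquiv h hN hTN hDT
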